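/- Let $D_9=\langle\sigma,\tau : \sigma^9=\tau^2=1,\ \tau\sigma\tau^{-1}=\sigma^{-1}\rangle$ be the dihedral group of order $18$. Let $D_9$ act on the rational function field $\mathbb{Q}(x_0,\dots,x_8)$ in nine variables by $\mathbb{Q}$-automorphisms via $\sigma(x_i)=x_{i+1}$ and $\tau(x_i)=x_{-i}$, with indices taken modulo $9$. Then the fixed field $\mathbb{Q}(x_0,\dots,x_8)^{D_9}$ is rational (that is, purely transcendental) over $\mathbb{Q}$. Moreover, letting $D_9$ act on the rational function field $\mathbb{Q}(x_g : g\in D_9)$ by $\mathbb{Q}$-automorphisms with $g\cdot x_h=x_{gh}$ for all $g,h\in D_9$, the fixed field $\mathbb{Q}(D_9)=\mathbb{Q}(x_g : g\in D_9)^{D_9}$ is also rational over $\mathbb{Q}$. -/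

import Mathlib

noncomputable section

/-- The rational function field `K(x_i : i ∈ ι)`. -/
abbrev RatFunField (K ι : Type*) [Field K] : Type _ :=
  FractionRing (MvPolynomial ι K)

/-- The variable `x_i` of the rational function field `K(x_i : i ∈ ι)`. -/
def RatFunField.X (K : Type*) {ι : Type*} [Field K] (i : ι) : RatFunField K ι :=
  algebraMap (MvPolynomial ι K) (RatFunField K ι) (MvPolynomial.X i)

/-- The action of a group `G` on the polynomial ring `K[x_i : i ∈ ι]` by `K`-automorphisms that
permutes the variables according to an action of `G` on the index set: `g · x_i = x_{g • i}`. -/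
def permVarsPoly (K G ι : Type*) [Field K] [Group G] [MulAction G ι] :
    G →* (MvPolynomial ι K ≃ₐ[K] MvPolynomial ι K) where
  toFun g := MvPolynomial.renameEquiv K (MulAction.toPerm g)
  map_one' := by
    refine AlgEquiv.ext fun p => ?_
    simp [MulAction.toPerm_one]
  map_mul' g h := by
    refine AlgEquiv.ext fun p => ?_
    change MvPolynomial.rename _ p = MvPolynomial.rename _ (MvPolynomial.rename _ p)
    rw [MvPolynomial.rename_rename]
    congr 2
    funext i
    exact mul_smul g h i

/-- The action of `G` on `K(x_i : i ∈ ι)` by `K`-automorphisms with `g · x_i = x_{g • i}`. -/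
def permVars (K G ι : Type*) [Field K] [Group G] [MulAction G ι] :
    G →* (RatFunField K ι ≃ₐ[K] RatFunField K ι) :=
  (IsFractionRing.fieldEquivOfAlgEquivHom K (RatFunField K ι)).comp (permVarsPoly K G ι)

theorem permVars_X (K G : Type*) {ι : Type*} [Field K] [Group G] [MulAction G ι] (g : G) (i : ι) :
    permVars K G ι g (RatFunField.X K i) = RatFunField.X K (g • i) := by
  simp [permVars, permVarsPoly, RatFunField.X]

/-- The fixed field `K(x_i : i ∈ ι)^G`. -/
def permFixedField (K G ι : Type*) [Field K] [Group G] [MulAction G ι] :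
    IntermediateField K (RatFunField K ι) :=
  IntermediateField.fixedField (permVars K G ι).range

theorem mem_permFixedField_iff (K G : Type*) {ι : Type*} [Field K] [Group G] [MulAction G ι]
    (f : RatFunField K ι) :
    f ∈ permFixedField K G ι ↔ ∀ g : G, permVars K G ι g f = f := by
  simp [permFixedField, IntermediateField.mem_fixedField_iff]

/-- The field `K(G) = K(x_g : g ∈ G)^G` of Noether's problem, where `g · x_h = x_{gh}`. -/
def noetherField (K G : Type*) [Field K] [Group G] : IntermediateField K (RatFunField K G) :=
  permFixedField K G G

/-- An extension `L` of `K` inside `E` is rational (that is, purely transcendental) over `K` if it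
is generated as a field over `K` by a set of algebraically independent elements. -/
def IsRationalExt {K E : Type*} [Field K] [Field E] {_ : Algebra K E}
    (L : IntermediateField K E) : Prop :=
  ∃ s : Set E, AlgebraicIndependent K (fun x : s => (x : E)) ∧ IntermediateField.adjoin K s = L

/-- The dihedral group `D_n` acts on `ℤ/n`: the rotation `σ = r 1` by `i ↦ i + 1`, the reflection
`τ = sr 0` by `i ↦ -i`, and hence `r a = σ ^ a` by `i ↦ a + i` and `sr a = τ σ ^ a` by
`i ↦ -(a + i)`. -/
instance dihedralMulAction (n : ℕ) : MulAction (DihedralGroup n) (ZMod n) where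
  smul g i := match g with
    | .r a => a + i
    | .sr a => -(a + i)
  one_smul i := zero_add i
  mul_smul g h i := by
    rcases g with a | a <;> rcases h with b | b
    · change a + b + i = a + (b + i); ring
    · change -(b - a + i) = a + -(b + i); ring
    · change -(a + b + i) = -(a + (b + i)); ring
    · change b - a + i = -(a + -(b + i)); ring

theorem dihedral_sigma_X (K : Type*) [Field K] (n : ℕ) (i : ZMod n) :
    permVars K (DihedralGroup n) (ZMod n) (.r 1) (RatFunField.X K i)
      = RatFunField.X K (i + 1) := by
  rw [permVars_X, add_comm]
  rfl

theorem dihedral_tau_X (K : Type*) [Field K] (n : ℕ) (i : ZMod n) :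
    permVars K (DihedralGroup n) (ZMod n) (.sr 0) (RatFunField.X K i)
      = RatFunField.X K (-i) := by
  rw [permVars_X]
  change RatFunField.X K (-(0 + i)) = _
  rw [zero_add]

end

/-! Let `E` carry a dihedral action permuting `x 0, …, x 8`, and adjoin a primitive ninth root of
unity `ζ` to get `L`. A rotation multiplies the Fourier coefficient `y_a = ∑ ζ^(aj) x_j` by a power
of `ζ` linear in `a`, so `y_a` has weight `a` mod 9; a reflection moreover replaces `a` by `-a`, and
the Galois group of `L` over `E` replaces `a` by `ab` for units `b`. Hence, for units `a`, the
monomials `z_a = y_a y_{4a} / y_{5a}` and `u_a = y_{3a} / (y_a y_{4a} y_{7a})` have weight 0: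
rotations fix them, reflections and Galois elements only permute them. Since `u_{4a} = u_a`, there
are six `z_a` and two `u_a`; with `y_0` this makes nine.

The periods `∑ ζ^(ka) f_a`, for `f = z` or `u`, are Galois invariant and so descend to `E`, and they
determine the `f_a` by Fourier inversion. A reflection maps the period at `k` to that at `-k`, so
symmetrising leaves five invariants and four elements that change sign. Multiplying these four by a
nonzero one among them gives nine dihedral invariants (`exists_dihedral_invariants`). If they lie in
`F` and the `x j` generate `E` over `F`, then `L` arises from `F` by adjoining `ζ`, that odd element
and `y_1`, in degrees at most 6, 2 and 9; dividing by `[L : E] = 6` gives `[E : F] ≤ 18`.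

For a faithful action, as many invariants as variables over which the degree is at most the group
order generate the fixed field, and transcendence degree makes them independent
(`isRationalExt_permFixedField`). In the regular representation the sums over right cosets of a
reflection play the role of the `x j`; nine further invariants, linear in the coset differences,
recover those differences. -/

noncomputable section

universe u

/-! ### Fourier coefficients, weight-zero monomials and periods modulo 9 -/

namespace NonicPeriods

variable {L : Type*} [Field L]

/-- The discrete Fourier transform of a vector indexed by `ZMod 9`. -/
def dft (e : AddChar (ZMod 9) L) (x : ZMod 9 → L) (a : ZMod 9) : L :=
  ∑ j, e (a * j) * x j

/-- A rotation invariant monomial in the Fourier coefficients of index prime to `9`. -/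
def unitMonomial (e : AddChar (ZMod 9) L) (x : ZMod 9 → L) (a : ZMod 9) : L :=
  dft e x a * dft e x (4 * a) / dft e x (5 * a)

/-- A rotation invariant monomial involving a Fourier coefficient of index divisible by `3`. -/
def cubicMonomial (e : AddChar (ZMod 9) L) (x : ZMod 9 → L) (a : ZMod 9) : L :=
  dft e x (3 * a) / (dft e x a * dft e x (4 * a) * dft e x (7 * a))

/-- The twisted sum of `f` over the units modulo `9`. -/
def period (e : AddChar (ZMod 9) L) (f : ZMod 9 → L) (k : ZMod 9) : L :=
  ∑ a : (ZMod 9)ˣ, e (k * a) * f a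

theorem map_dft_rotate (φ : L →+* L) {e : AddChar (ZMod 9) L} {x : ZMod 9 → L} {t : ZMod 9}
    (he : ∀ a, φ (e a) = e a) (hx : ∀ j, φ (x j) = x (t + j)) (a : ZMod 9) :
    φ (dft e x a) = e (-(a * t)) * dft e x a := by
  simp only [dft, map_sum, map_mul, he, hx, Finset.mul_sum]
  refine Fintype.sum_equiv (Equiv.addLeft t) _ _ fun j => ?_
  rw [← mul_assoc, ← AddChar.map_add_eq_mul, Equiv.coe_addLeft]
  congr 2
  ring

theorem map_dft_reflect (φ : L →+* L) {e : AddChar (ZMod 9) L} {x : ZMod 9 → L} {t : ZMod 9}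
    (he : ∀ a, φ (e a) = e a) (hx : ∀ j, φ (x j) = x (-(t + j))) (a : ZMod 9) :
    φ (dft e x a) = e (-(a * t)) * dft e x (-a) := by
  simp only [dft, map_sum, map_mul, he, hx, Finset.mul_sum]
  refine Fintype.sum_equiv ((Equiv.addLeft t).trans (Equiv.neg _)) _ _ fun j => ?_
  rw [← mul_assoc, ← AddChar.map_add_eq_mul, Equiv.trans_apply, Equiv.coe_addLeft, Equiv.neg_apply]
  congr 2
  ring

theorem map_dft_galois (φ : L →+* L) {e : AddChar (ZMod 9) L} {x : ZMod 9 → L} {b : ZMod 9}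
    (he : ∀ a, φ (e a) = e (a * b)) (hx : ∀ j, φ (x j) = x j) (a : ZMod 9) :
    φ (dft e x a) = dft e x (a * b) := by
  simp only [dft, map_sum, map_mul, he, hx, mul_right_comm]

theorem nine_eq_zero : (9 : ZMod 9) = 0 := rfl

/-- The weights cancel: `a + 4a - 5a = 0`. Taking `s = 1` covers rotations, `s = -1` reflections. -/
theorem map_unitMonomial_of_twist (φ : L →+* L) {e : AddChar (ZMod 9) L} {x : ZMod 9 → L}
    {t s : ZMod 9} (h : ∀ a, φ (dft e x a) = e (-(a * t)) * dft e x (s * a)) (a : ZMod 9) :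
    φ (unitMonomial e x a) = unitMonomial e x (s * a) := by
  simp only [unitMonomial, map_div₀, map_mul, h]
  rw [mul_mul_mul_comm, ← AddChar.map_add_eq_mul,
    show -(a * t) + -(4 * a * t) = -(5 * a * t) by ring,
    mul_div_mul_left _ _ (e.val_isUnit _).ne_zero]
  simp only [mul_left_comm s]

/-- The weights cancel because `a + 4a + 7a = 12a = 3a` modulo 9. -/
theorem map_cubicMonomial_of_twist (φ : L →+* L) {e : AddChar (ZMod 9) L} {x : ZMod 9 → L}
    {t s : ZMod 9} (h : ∀ a, φ (dft e x a) = e (-(a * t)) * dft e x (s * a)) (a : ZMod 9) :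
    φ (cubicMonomial e x a) = cubicMonomial e x (s * a) := by
  simp only [cubicMonomial, map_div₀, map_mul, h]
  rw [mul_mul_mul_comm (e (-(a * t))), mul_mul_mul_comm (e (-(a * t)) * _),
    ← AddChar.map_add_eq_mul, ← AddChar.map_add_eq_mul,
    show -(a * t) + -(4 * a * t) + -(7 * a * t) = -(3 * a * t) by
      linear_combination -(a * t) * nine_eq_zero,
    mul_div_mul_left _ _ (e.val_isUnit _).ne_zero]
  simp only [mul_left_comm s]

theorem map_unitMonomial_galois (φ : L →+* L) {e : AddChar (ZMod 9) L} {x : ZMod 9 → L}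
    {b : ZMod 9} (h : ∀ a, φ (dft e x a) = dft e x (a * b)) (a : ZMod 9) :
    φ (unitMonomial e x a) = unitMonomial e x (a * b) := by
  simp only [unitMonomial, map_div₀, map_mul, h, mul_assoc]

theorem map_cubicMonomial_galois (φ : L →+* L) {e : AddChar (ZMod 9) L} {x : ZMod 9 → L}
    {b : ZMod 9} (h : ∀ a, φ (dft e x a) = dft e x (a * b)) (a : ZMod 9) :
    φ (cubicMonomial e x a) = cubicMonomial e x (a * b) := by
  simp only [cubicMonomial, map_div₀, map_mul, h, mul_assoc]

theorem map_period_galois (φ : L →+* L) {e : AddChar (ZMod 9) L} {f : ZMod 9 → L} (b : (ZMod 9)ˣ)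
    (he : ∀ a, φ (e a) = e (a * b)) (hf : ∀ a, φ (f a) = f (a * b)) (k : ZMod 9) :
    φ (period e f k) = period e f k := by
  simp only [period, map_sum, map_mul, he, hf]
  exact Fintype.sum_equiv (Equiv.mulRight b) _ _ fun a => by simp [mul_assoc]

theorem map_period_of_fixed (φ : L →+* L) {e : AddChar (ZMod 9) L} {f : ZMod 9 → L}
    (he : ∀ a, φ (e a) = e a) (hf : ∀ a, φ (f a) = f a) (k : ZMod 9) :
    φ (period e f k) = period e f k := by
  simp only [period, map_sum, map_mul, he, hf]

theorem map_period_of_neg (φ : L →+* L) {e : AddChar (ZMod 9) L} {f : ZMod 9 → L}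
    (he : ∀ a, φ (e a) = e a) (hf : ∀ a, φ (f a) = f (-a)) (k : ZMod 9) :
    φ (period e f k) = period e f (-k) := by
  simp only [period, map_sum, map_mul, he, hf]
  exact Fintype.sum_equiv (Equiv.neg _) _ _ fun a => by simp

/-- This is Fourier inversion for `f` extended by zero to the non-units. -/
theorem period_inversion {e : AddChar (ZMod 9) L} (he : e.IsPrimitive) (f : ZMod 9 → L)
    (b : (ZMod 9)ˣ) : ∑ k, e (-(k * b)) * period e f k = 9 * f b := by
  simp only [period, Finset.mul_sum, ← mul_assoc, ← AddChar.map_add_eq_mul]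
  rw [Finset.sum_comm]
  simp only [← Finset.sum_mul]
  have h (a : (ZMod 9)ˣ) : ∑ k : ZMod 9, e (-(k * b) + k * a) = if a = b then 9 else 0 := by
    have := AddChar.sum_mulShift ((a : ZMod 9) - b) he
    simp only [sub_eq_zero, Units.val_inj] at this
    simp only [neg_add_eq_sub, ← mul_sub, this]
    simp [ZMod.card]
  simp [h]

theorem dft_inversion {e : AddChar (ZMod 9) L} (he : e.IsPrimitive) (x : ZMod 9 → L)
    (j : ZMod 9) : ∑ k, e (-(k * j)) * dft e x k = 9 * x j := by
  simp only [dft, Finset.mul_sum, ← mul_assoc, ← AddChar.map_add_eq_mul]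
  rw [Finset.sum_comm]
  simp only [← Finset.sum_mul]
  have h (a : ZMod 9) : ∑ k : ZMod 9, e (-(k * j) + k * a) = if a = j then 9 else 0 := by
    have := AddChar.sum_mulShift (a - j) he
    simp only [sub_eq_zero] at this
    simp only [neg_add_eq_sub, ← mul_sub, this]
    simp [ZMod.card]
  simp [h]

/-- The sum of the three cube roots of unity, in terms of a primitive additive character. -/
theorem sum_thirds {e : AddChar (ZMod 9) L} (he : e.IsPrimitive) {a : ZMod 9} (ha : 3 * a ≠ 0) :
    1 + e (3 * a) + e (6 * a) = 0 := by
  have h1 : e (3 * a) ≠ 1 := fun h => ha ((he.zmod_char_eq_one_iff 9 _).1 h)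
  have h3 : e (3 * a) ^ 3 = 1 := by
    rw [← AddChar.map_nsmul_eq_pow, nsmul_eq_mul,
      show ((3 : ℕ) : ZMod 9) * (3 * a) = 0 by push_cast; linear_combination a * nine_eq_zero,
      AddChar.map_zero_eq_one]
  have h2 : e (6 * a) = e (3 * a) ^ 2 := by
    rw [← AddChar.map_nsmul_eq_pow, nsmul_eq_mul]
    congr 1; push_cast; ring
  rw [h2]
  refine (mul_eq_zero.1 ?_).resolve_left (sub_ne_zero.2 h1)
  linear_combination h3

/-- Shifting `k` by 3 multiplies each term by a primitive cube root of unity. These relations leave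
only six periods to be controlled, as many as there are units. -/
theorem period_add_thirds {e : AddChar (ZMod 9) L} (he : e.IsPrimitive) (f : ZMod 9 → L)
    (k : ZMod 9) : period e f k + period e f (k + 3) + period e f (k + 6) = 0 := by
  simp only [period, ← Finset.sum_add_distrib, add_mul, AddChar.map_add_eq_mul]
  refine Finset.sum_eq_zero fun a _ => ?_
  have h : (3 : ZMod 9) * a ≠ 0 := by
    rw [Ne, Units.mul_left_eq_zero]; decide
  linear_combination e (k * a) * f a * sum_thirds he h

end NonicPeriods

/-! ### Degree bounds for adjoining one element -/

/-- The field is `N(a)`, regarded over `F` so that such steps can be stacked into a tower inside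
`L`. -/
theorem IntermediateField.exists_finrank_le_mul_natDegree {F L : Type*} [Field F] [Field L]
    [Algebra F L] (N : IntermediateField F L) [FiniteDimensional F N] {p : Polynomial N}
    (hp : p.Monic) {a : L} (ha : Polynomial.aeval a p = 0) :
    ∃ M : IntermediateField F L, N ≤ M ∧ a ∈ M ∧ FiniteDimensional F M ∧
      Module.finrank F M ≤ Module.finrank F N * p.natDegree := by
  have hint : IsIntegral N a := ⟨p, hp, ha⟩
  have : FiniteDimensional N (IntermediateField.adjoin N {a}) :=
    IntermediateField.adjoin.finiteDimensional hint
  have : Module.Free N (IntermediateField.adjoin N {a}) := Module.Free.of_divisionRing _ _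
  refine ⟨(IntermediateField.adjoin N {a}).restrictScalars F, fun z hz => ?_,
    IntermediateField.mem_adjoin_simple_self N a, ?_, ?_⟩
  · exact (IntermediateField.adjoin N {a}).algebraMap_mem ⟨z, hz⟩
  · exact FiniteDimensional.trans F N (IntermediateField.adjoin N {a})
  · change Module.finrank F (IntermediateField.adjoin N {a}) ≤ _
    rw [← Module.finrank_mul_finrank F N (IntermediateField.adjoin N {a}),
      IntermediateField.adjoin.finrank hint]
    exact Nat.mul_le_mul_left _ (Polynomial.natDegree_le_natDegree (minpoly.min N a hp ha))

theorem IntermediateField.exists_finrank_le_mul_of_pow_mem {F L : Type*} [Field F] [Field L]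
    [Algebra F L] (N : IntermediateField F L) [FiniteDimensional F N] {n : ℕ} (hn : n ≠ 0)
    {a : L} (ha : a ^ n ∈ N) :
    ∃ M : IntermediateField F L, N ≤ M ∧ a ∈ M ∧ FiniteDimensional F M ∧
      Module.finrank F M ≤ Module.finrank F N * n := by
  have := N.exists_finrank_le_mul_natDegree
    (Polynomial.monic_X_pow_sub_C (⟨a ^ n, ha⟩ : N) hn) (a := a) (by simp)
  rwa [Polynomial.natDegree_X_pow_sub_C] at this

/-! ### Recovering the variables from the monomials and the monomials from the periods -/

namespace NonicPeriods

variable {F L : Type*} [Field F] [Field L] [Algebra F L]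

theorem unitMonomial_values (e : AddChar (ZMod 9) L) (x : ZMod 9 → L) :
    unitMonomial e x 1 = dft e x 1 * dft e x 4 / dft e x 5 ∧
    unitMonomial e x 2 = dft e x 2 * dft e x 8 / dft e x 1 ∧
    unitMonomial e x 4 = dft e x 4 * dft e x 7 / dft e x 2 ∧
    unitMonomial e x 5 = dft e x 5 * dft e x 2 / dft e x 7 ∧
    unitMonomial e x 7 = dft e x 7 * dft e x 1 / dft e x 8 ∧
    unitMonomial e x 8 = dft e x 8 * dft e x 5 / dft e x 4 := ⟨rfl, rfl, rfl, rfl, rfl, rfl⟩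

/-- The ninth power of `y_1` has weight 0, and it is a Laurent monomial in the `z_a`. Adjoining
`y_1` therefore costs degree at most 9. -/
theorem dft_one_pow_mem (N : IntermediateField F L) {e : AddChar (ZMod 9) L} {x : ZMod 9 → L}
    (hy : ∀ a : (ZMod 9)ˣ, dft e x a ≠ 0) (hz : ∀ a : (ZMod 9)ˣ, unitMonomial e x a ∈ N) :
    dft e x 1 ^ 9 ∈ N := by
  have hy' (a : ZMod 9) (ha : IsUnit a) : dft e x a ≠ 0 := hy ha.unit
  have hz' (a : ZMod 9) (ha : IsUnit a) : unitMonomial e x a ∈ N := hz ha.unit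
  have y1 := hy' 1 (by decide)
  have y2 := hy' 2 (by decide)
  have y4 := hy' 4 (by decide)
  have y5 := hy' 5 (by decide)
  have y7 := hy' 7 (by decide)
  have y8 := hy' 8 (by decide)
  obtain ⟨h1, h2, h4, h5, h7, h8⟩ := unitMonomial_values e x
  -- The exponents solve the linear system comparing powers of each `y_a` on both sides.
  have key : dft e x 1 ^ 9 = unitMonomial e x 5 * unitMonomial e x 1 ^ 5 *
      unitMonomial e x 8 ^ 4 * unitMonomial e x 7 ^ 2 /
        (unitMonomial e x 4 * unitMonomial e x 2 ^ 2) := by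
    rw [h1, h2, h4, h5, h7, h8]
    field_simp
  rw [key]
  exact div_mem (mul_mem (mul_mem (mul_mem (hz' 5 (by decide)) (pow_mem (hz' 1 (by decide)) _))
    (pow_mem (hz' 8 (by decide)) _)) (pow_mem (hz' 7 (by decide)) _))
    (mul_mem (hz' 4 (by decide)) (pow_mem (hz' 2 (by decide)) _))

/-- Once `y_1` is available, the `z_a` yield the other `y_a` with `a` a unit one by one, the `u_a`
yield `y_3` and `y_6`, and Fourier inversion yields the `x j`. -/
theorem mem_of_unitMonomial_mem (N : IntermediateField F L) {e : AddChar (ZMod 9) L}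
    {x : ZMod 9 → L} (h9 : (9 : L) ≠ 0) (hep : e.IsPrimitive) (he : ∀ a, e a ∈ N)
    (hy : ∀ a : (ZMod 9)ˣ, dft e x a ≠ 0) (hz : ∀ a : (ZMod 9)ˣ, unitMonomial e x a ∈ N)
    (hu : ∀ a : (ZMod 9)ˣ, cubicMonomial e x a ∈ N) (hy0 : dft e x 0 ∈ N)
    (hy1 : dft e x 1 ∈ N) (j : ZMod 9) : x j ∈ N := by
  have hy' (a : ZMod 9) (ha : IsUnit a) : dft e x a ≠ 0 := hy ha.unit
  have hz' (a : ZMod 9) (ha : IsUnit a) : unitMonomial e x a ∈ N := hz ha.unit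
  have hu' (a : ZMod 9) (ha : IsUnit a) : cubicMonomial e x a ∈ N := hu ha.unit
  have y1 := hy' 1 (by decide)
  have y2 := hy' 2 (by decide)
  have y4 := hy' 4 (by decide)
  have y5 := hy' 5 (by decide)
  have y7 := hy' 7 (by decide)
  have y8 := hy' 8 (by decide)
  have z1 := hz' 1 (by decide)
  have z2 := hz' 2 (by decide)
  have z4 := hz' 4 (by decide)
  have z7 := hz' 7 (by decide)
  have z8 := hz' 8 (by decide)
  obtain ⟨h1, h2, h4, -, h7, h8⟩ := unitMonomial_values e x
  have m8 : dft e x 8 ∈ N := by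
    -- In `z_1 z_8` the factors `y_4` and `y_5` cancel, leaving `y_1 y_8`.
    have : dft e x 8 = unitMonomial e x 1 * unitMonomial e x 8 / dft e x 1 := by
      rw [h1, h8]; field_simp
    exact this ▸ div_mem (mul_mem z1 z8) hy1
  have m7 : dft e x 7 ∈ N := by
    have : dft e x 7 = unitMonomial e x 7 * dft e x 8 / dft e x 1 := by
      rw [h7]; field_simp
    exact this ▸ div_mem (mul_mem z7 m8) hy1
  have m2 : dft e x 2 ∈ N := by
    have : dft e x 2 = unitMonomial e x 2 * dft e x 1 / dft e x 8 := by
      rw [h2]; field_simp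
    exact this ▸ div_mem (mul_mem z2 hy1) m8
  have m4 : dft e x 4 ∈ N := by
    have : dft e x 4 = unitMonomial e x 4 * dft e x 2 / dft e x 7 := by
      rw [h4]; field_simp
    exact this ▸ div_mem (mul_mem z4 m2) m7
  have m5 : dft e x 5 ∈ N := by
    have : dft e x 5 = dft e x 1 * dft e x 4 / unitMonomial e x 1 := by
      rw [h1]; field_simp
    exact this ▸ div_mem (mul_mem hy1 m4) z1
  have m3 : dft e x 3 ∈ N := by
    have : dft e x 3 = cubicMonomial e x 1 * (dft e x 1 * dft e x 4 * dft e x 7) := by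
      rw [show cubicMonomial e x 1 = dft e x 3 / (dft e x 1 * dft e x 4 * dft e x 7) from rfl]
      field_simp
    exact this ▸ mul_mem (hu' 1 (by decide)) (mul_mem (mul_mem hy1 m4) m7)
  have m6 : dft e x 6 ∈ N := by
    have : dft e x 6 = cubicMonomial e x 8 * (dft e x 8 * dft e x 5 * dft e x 2) := by
      rw [show cubicMonomial e x 8 = dft e x 6 / (dft e x 8 * dft e x 5 * dft e x 2) from rfl]
      field_simp
    exact this ▸ mul_mem (hu' 8 (by decide)) (mul_mem (mul_mem m8 m5) m2)
  have hm (k : ZMod 9) : dft e x k ∈ N := by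
    fin_cases k
    exacts [hy0, hy1, m2, m3, m4, m5, m6, m7, m8]
  have hx : x j = (∑ k, e (-(k * j)) * dft e x k) / 9 := by
    rw [dft_inversion hep, mul_div_cancel_left₀ _ h9]
  rw [hx]
  exact div_mem (sum_mem fun k _ => mul_mem (he _) (hm k)) (ofNat_mem N 9)

/-- Three sums and three differences suffice: with the three relations from `period_add_thirds` they
determine all nine periods. -/
theorem mem_of_period_mem (N : IntermediateField F L) {e : AddChar (ZMod 9) L} {f : ZMod 9 → L}
    (h9 : (9 : L) ≠ 0) (h2 : (2 : L) ≠ 0) (hep : e.IsPrimitive) (he : ∀ a, e a ∈ N)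
    (heven : ∀ k ∈ ({0, 1, 2} : Set (ZMod 9)), period e f k + period e f (-k) ∈ N)
    (hodd : ∀ k ∈ ({1, 2, 3} : Set (ZMod 9)), period e f k - period e f (-k) ∈ N)
    (a : (ZMod 9)ˣ) : f a ∈ N := by
  have p0 := period_add_thirds hep f 0
  have p1 := period_add_thirds hep f 1
  have p2 := period_add_thirds hep f 2
  have A0 : period e f 0 + period e f 0 ∈ N := heven 0 (by simp)
  have A1 : period e f 1 + period e f 8 ∈ N := heven 1 (by simp)
  have A2 : period e f 2 + period e f 7 ∈ N := heven 2 (by simp)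
  have B1 : period e f 1 - period e f 8 ∈ N := hodd 1 (by simp)
  have B2 : period e f 2 - period e f 7 ∈ N := hodd 2 (by simp)
  have B3 : period e f 3 - period e f 6 ∈ N := hodd 3 (by simp)
  replace p0 : period e f 0 + period e f 3 + period e f 6 = 0 := p0
  replace p1 : period e f 1 + period e f 4 + period e f 7 = 0 := p1
  replace p2 : period e f 2 + period e f 5 + period e f 8 = 0 := p2
  have half {c d : L} (h : c + c = d) (hd : d ∈ N) : c ∈ N := by
    have : c = d / 2 := by field_simp; linear_combination h
    exact this ▸ div_mem hd (ofNat_mem N 2)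
  have t0 : period e f 0 ∈ N := half rfl A0
  have t1 : period e f 1 ∈ N := half (by ring) (add_mem A1 B1)
  have t8 : period e f 8 ∈ N := half (by ring) (sub_mem A1 B1)
  have t2 : period e f 2 ∈ N := half (by ring) (add_mem A2 B2)
  have t7 : period e f 7 ∈ N := half (by ring) (sub_mem A2 B2)
  have t3 : period e f 3 ∈ N := half (by linear_combination p0) (sub_mem B3 t0)
  have t6 : period e f 6 ∈ N := by
    have : period e f 6 = period e f 3 - (period e f 3 - period e f 6) := by ring
    exact this ▸ sub_mem t3 B3
  have t4 : period e f 4 ∈ N := by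
    have : period e f 4 = -(period e f 1 + period e f 7) := by linear_combination p1
    exact this ▸ neg_mem (add_mem t1 t7)
  have t5 : period e f 5 ∈ N := by
    have : period e f 5 = -(period e f 2 + period e f 8) := by linear_combination p2
    exact this ▸ neg_mem (add_mem t2 t8)
  have hm (k : ZMod 9) : period e f k ∈ N := by
    fin_cases k
    exacts [t0, t1, t2, t3, t4, t5, t6, t7, t8]
  have hx : f a = (∑ k, e (-(k * a)) * period e f k) / 9 := by
    rw [period_inversion hep, mul_div_cancel_left₀ _ h9]
  rw [hx]
  exact div_mem (sum_mem fun k _ => mul_mem (he _) (hm k)) (ofNat_mem N 9)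

/-- Invariance of `f` under multiplication by 4 passes to the periods. For a unit `k` the indices
`k`, `k + 3`, `k + 6` are `k`, `4k`, `16k` in some order, so the relation among thirds becomes three
times one period. -/
theorem period_eq_zero {e : AddChar (ZMod 9) L} {f : ZMod 9 → L} (h3 : (3 : L) ≠ 0)
    (hep : e.IsPrimitive) (hf : ∀ a, f (4 * a) = f a) {k : ZMod 9} (hk : IsUnit k) :
    period e f k = 0 := by
  have h4 (m : ZMod 9) : period e f (4 * m) = period e f m := by
    refine Fintype.sum_equiv (Equiv.mulLeft (⟨4, 7, rfl, rfl⟩ : (ZMod 9)ˣ)) _ _ fun a => ?_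
    simp only [Equiv.coe_mulLeft, Units.val_mul, hf]
    rw [mul_left_comm, mul_assoc]
  have hsum := period_add_thirds hep f k
  have cases : ∀ k : ZMod 9, IsUnit k → (k + 3 = 4 * k ∧ k + 6 = 4 * (4 * k)) ∨
      (k + 6 = 4 * k ∧ k + 3 = 4 * (4 * k)) := by decide
  rcases cases k hk with ⟨h, h'⟩ | ⟨h, h'⟩ <;> rw [h, h'] at hsum <;> simp only [h4] at hsum <;>
    exact (mul_eq_zero.1 (by linear_combination hsum :
      (3 : L) * period e f k = 0)).resolve_left h3

theorem cubicMonomial_four_mul (e : AddChar (ZMod 9) L) (x : ZMod 9 → L) (a : ZMod 9) :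
    cubicMonomial e x (4 * a) = cubicMonomial e x a := by
  have h1 : 3 * (4 * a) = 3 * a := by linear_combination a * nine_eq_zero
  have h2 : 4 * (4 * a) = 7 * a := by linear_combination a * nine_eq_zero
  have h3 : 7 * (4 * a) = a := by linear_combination 3 * a * nine_eq_zero
  rw [cubicMonomial, cubicMonomial, h1, h2, h3]
  congr 1
  ring

end NonicPeriods

/-! ### Adjoining a root of unity compatibly with endomorphisms -/

open Polynomial in
/-- A field with irreducible `n`-th cyclotomic polynomial has an extension generated by a primitive
`n`-th root of unity `ζ` to which every endomorphism of the field extends fixing `ζ`. -/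
theorem exists_cyclotomic_extension_lift {E : Type u} [Field E] {n : ℕ} [NeZero (n : E)]
    (hirr : Irreducible (cyclotomic n E)) :
    ∃ (L : Type u) (_ : Field L) (_ : Algebra E L) (ζ : L), IsPrimitiveRoot ζ n ∧
      IntermediateField.adjoin E {ζ} = ⊤ ∧ IsCyclotomicExtension {n} E L ∧
      ∀ φ : E →+* E, ∃ ψ : L →+* L, (∀ c, ψ (algebraMap E L c) = algebraMap E L (φ c)) ∧
        ψ ζ = ζ := by
  have : Fact (Irreducible (cyclotomic n E)) := ⟨hirr⟩
  have hn : NeZero n := ⟨fun h => NeZero.ne (n : E) (by simp [h])⟩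
  have : NeZero (n : AdjoinRoot (cyclotomic n E)) :=
    NeZero.nat_of_injective (algebraMap E (AdjoinRoot (cyclotomic n E))).injective
  have hroot : IsPrimitiveRoot (AdjoinRoot.root (cyclotomic n E)) n := by
    rw [← isRoot_cyclotomic_iff, ← map_cyclotomic n (AdjoinRoot.of (cyclotomic n E))]
    exact AdjoinRoot.isRoot_root _
  have htop := AdjoinRoot.adjoinRoot_eq_top (f := cyclotomic n E)
  -- The cyclotomic polynomial has integer coefficients, so `φ` does not change it and its root may
  -- be sent to itself.
  have hlift (φ : E →+* E) : (cyclotomic n E).eval₂ ((AdjoinRoot.of (cyclotomic n E)).comp φ)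
      (AdjoinRoot.root (cyclotomic n E)) = 0 := by
    rw [← eval₂_map, map_cyclotomic]
    exact AdjoinRoot.eval₂_root _
  refine ⟨AdjoinRoot (cyclotomic n E), inferInstance, inferInstance, AdjoinRoot.root _, hroot,
    ?_, ?_, fun φ => ⟨AdjoinRoot.lift _ _ (hlift φ), fun c => AdjoinRoot.lift_of (hlift φ),
      AdjoinRoot.lift_root (hlift φ)⟩⟩
  · rw [eq_top_iff]
    intro z _
    exact IntermediateField.algebra_adjoin_le_adjoin E _ (htop ▸ Algebra.mem_top)
  · have := hroot.adjoin_isCyclotomicExtension E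
    exact IsCyclotomicExtension.equiv {n} E _
      ((Subalgebra.equivOfEq _ _ htop).trans Subalgebra.topEquiv)

theorem IsPrimitiveRoot.exists_unit_map_zmodChar {E L : Type*} [Field E] [Field L] [Algebra E L]
    {n : ℕ} [NeZero n] {ζ : L} (hζ : IsPrimitiveRoot ζ n) (g : L ≃ₐ[E] L) :
    ∃ b : (ZMod n)ˣ, ∀ a, g (AddChar.zmodChar n hζ.pow_eq_one a) =
      AddChar.zmodChar n hζ.pow_eq_one (a * b) := by
  refine ⟨hζ.autToPow E g, fun a => ?_⟩
  have h : g ζ = AddChar.zmodChar n hζ.pow_eq_one (hζ.autToPow E g : ZMod n) :=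
    (hζ.autToPow_spec E g).symm
  rw [AddChar.zmodChar_apply, map_pow, h, ← AddChar.map_nsmul_eq_pow, nsmul_eq_mul,
    ZMod.natCast_zmod_val]

/-! ### Nonvanishing of Fourier coefficients and the nine dihedral invariants -/

namespace NonicPeriods

open Polynomial in
-- A primitive ninth root of unity has degree 6 over `E`, so it is not a root of a nonzero
-- polynomial of degree at most 5.
theorem dft_ne_zero {E L : Type*} [Field E] [Field L] [Algebra E L] [NeZero (9 : E)]
    (hirr : Irreducible (cyclotomic 9 E)) {ζ : L} (hζ : IsPrimitiveRoot ζ 9) {x : ZMod 9 → E}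
    (hx : x 0 ≠ x 6) (a : (ZMod 9)ˣ) :
    dft (AddChar.zmodChar 9 hζ.pow_eq_one) (fun j => algebraMap E L (x j)) a ≠ 0 := by
  intro h0
  set e := AddChar.zmodChar 9 hζ.pow_eq_one
  have hprim : IsPrimitiveRoot (e a) 9 := by
    rw [AddChar.zmodChar_apply]
    exact hζ.pow_of_coprime _ (ZMod.val_coe_unit_coprime a)
  have : NeZero ((9 : ℕ) : E) := ⟨by exact_mod_cast NeZero.ne (9 : E)⟩
  have hmin := hprim.minpoly_eq_cyclotomic_of_irreducible hirr
  -- The remainder of `∑ x_j X^j` modulo `X^6 + X^3 + 1`; its constant term is `x 0 - x 6`.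
  set Q : E[X] := C (x 0 - x 6) + C (x 1 - x 7) * X + C (x 2 - x 8) * X ^ 2 +
    C (x 3 - x 6) * X ^ 3 + C (x 4 - x 7) * X ^ 4 + C (x 5 - x 8) * X ^ 5 with hQ
  have hpow (j : ℕ) : e (a * j) = e a ^ j := by
    rw [← AddChar.map_nsmul_eq_pow, nsmul_eq_mul, mul_comm]
  have hthird : 1 + e a ^ 3 + e a ^ 6 = 0 := by
    have := sum_thirds (AddChar.zmodChar_primitive_of_primitive_root 9 hζ) (a := a)
      (by rw [Ne, Units.mul_left_eq_zero]; decide)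
    rw [← hpow, ← hpow]
    simpa only [mul_comm, Nat.cast_ofNat] using this
  have hsum' (f : Fin 9 → L) :
      ∑ j, f j = f 0 + f 1 + f 2 + f 3 + f 4 + f 5 + f 6 + f 7 + f 8 := by
    rw [Fin.sum_univ_castSucc, Fin.sum_univ_eight]
    rfl
  have hsum (f : ZMod 9 → L) :
      ∑ j, f j = f 0 + f 1 + f 2 + f 3 + f 4 + f 5 + f 6 + f 7 + f 8 := hsum' f
  have p2 : e (a * 2) = e a ^ 2 := by exact_mod_cast hpow 2
  have p3 : e (a * 3) = e a ^ 3 := by exact_mod_cast hpow 3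
  have p4 : e (a * 4) = e a ^ 4 := by exact_mod_cast hpow 4
  have p5 : e (a * 5) = e a ^ 5 := by exact_mod_cast hpow 5
  have p6 : e (a * 6) = e a ^ 6 := by exact_mod_cast hpow 6
  have p7 : e (a * 7) = e a ^ 7 := by exact_mod_cast hpow 7
  have p8 : e (a * 8) = e a ^ 8 := by exact_mod_cast hpow 8
  have hexp := h0
  rw [dft, hsum, mul_zero, AddChar.map_zero_eq_one, mul_one, p2, p3, p4, p5, p6, p7, p8] at hexp
  have hQroot : aeval (e a) Q = 0 := by
    simp only [hQ, map_add, map_sub, map_mul, map_pow, aeval_X, aeval_C]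
    linear_combination hexp - (algebraMap E L (x 6) + e a * algebraMap E L (x 7) +
      e a ^ 2 * algebraMap E L (x 8)) * hthird
  have hdeg : Q.natDegree ≤ 5 := by rw [hQ]; compute_degree
  have hQ0 : Q = 0 := by
    refine eq_zero_of_dvd_of_natDegree_lt (minpoly.dvd E _ hQroot) ?_
    rw [← hmin, natDegree_cyclotomic]
    exact lt_of_le_of_lt hdeg (by decide)
  have : Q.coeff 0 = 0 := by rw [hQ0, coeff_zero]
  simp [hQ] at this
  exact hx (sub_eq_zero.1 this)

variable {E L : Type*} [Field E] [Field L] [Algebra E L]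

/-- The reflection invariant generators: the zeroth Fourier coefficient and symmetrised periods. -/
def evenGenerator (e : AddChar (ZMod 9) L) (x : ZMod 9 → L) : Fin 5 → L :=
  ![dft e x 0,
    period e (unitMonomial e x) 0 + period e (unitMonomial e x) (-0),
    period e (unitMonomial e x) 1 + period e (unitMonomial e x) (-1),
    period e (unitMonomial e x) 2 + period e (unitMonomial e x) (-2),
    period e (cubicMonomial e x) 0 + period e (cubicMonomial e x) (-0)]

/-- The antisymmetrised periods, whose sign is changed by reflections. -/
def oddGenerator (e : AddChar (ZMod 9) L) (x : ZMod 9 → L) : Fin 4 → L :=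
  ![period e (unitMonomial e x) 1 - period e (unitMonomial e x) (-1),
    period e (unitMonomial e x) 2 - period e (unitMonomial e x) (-2),
    period e (unitMonomial e x) 3 - period e (unitMonomial e x) (-3),
    period e (cubicMonomial e x) 3 - period e (cubicMonomial e x) (-3)]

theorem map_generator_of_fixed (φ : L →+* L) {e : AddChar (ZMod 9) L} {x : ZMod 9 → L}
    (h0 : φ (dft e x 0) = dft e x 0)
    (hz : ∀ k, φ (period e (unitMonomial e x) k) = period e (unitMonomial e x) k)
    (hu : ∀ k, φ (period e (cubicMonomial e x) k) = period e (cubicMonomial e x) k) :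
    (∀ i, φ (evenGenerator e x i) = evenGenerator e x i) ∧
      ∀ i, φ (oddGenerator e x i) = oddGenerator e x i := by
  refine ⟨fun i => ?_, fun i => ?_⟩ <;> fin_cases i <;>
    simp [evenGenerator, oddGenerator, h0, hz, hu]

theorem map_generator_of_neg (φ : L →+* L) {e : AddChar (ZMod 9) L} {x : ZMod 9 → L}
    (h0 : φ (dft e x 0) = dft e x 0)
    (hz : ∀ k, φ (period e (unitMonomial e x) k) = period e (unitMonomial e x) (-k))
    (hu : ∀ k, φ (period e (cubicMonomial e x) k) = period e (cubicMonomial e x) (-k)) :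
    (∀ i, φ (evenGenerator e x i) = evenGenerator e x i) ∧
      ∀ i, φ (oddGenerator e x i) = -oddGenerator e x i := by
  refine ⟨fun i => ?_, fun i => ?_⟩ <;> fin_cases i <;>
    simp only [evenGenerator, oddGenerator, Matrix.cons_val, map_add, map_sub, h0, hz, hu,
      neg_neg, neg_sub, Fin.zero_eta, Fin.mk_one, Fin.reduceFinMk] <;> ring

theorem map_generator_dihedral (φ : L →+* L) {e : AddChar (ZMod 9) L} {x : ZMod 9 → L}
    (he : ∀ a, φ (e a) = e a) {g : DihedralGroup 9} (hx : ∀ j, φ (x j) = x (g • j)) :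
    (∀ i, φ (evenGenerator e x i) = evenGenerator e x i) ∧
      ((∀ i, φ (oddGenerator e x i) = oddGenerator e x i) ∨
        ∀ i, φ (oddGenerator e x i) = -oddGenerator e x i) := by
  rcases g with t | t
  · have h := map_dft_rotate φ he (t := t) hx
    have h' (a : ZMod 9) : φ (dft e x a) = e (-(a * t)) * dft e x (1 * a) := by rw [h, one_mul]
    have := map_generator_of_fixed φ (e := e) (x := x) (by simp [h])
      (map_period_of_fixed φ he fun a => by rw [map_unitMonomial_of_twist φ h', one_mul])
      (map_period_of_fixed φ he fun a => by rw [map_cubicMonomial_of_twist φ h', one_mul])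
    exact ⟨this.1, .inl this.2⟩
  · have h := map_dft_reflect φ he (t := t) hx
    have h' (a : ZMod 9) : φ (dft e x a) = e (-(a * t)) * dft e x (-1 * a) := by
      rw [h, neg_one_mul]
    have := map_generator_of_neg φ (e := e) (x := x) (by simp [h])
      (map_period_of_neg φ he fun a => by rw [map_unitMonomial_of_twist φ h', neg_one_mul])
      (map_period_of_neg φ he fun a => by rw [map_cubicMonomial_of_twist φ h', neg_one_mul])
    exact ⟨this.1, .inr this.2⟩

theorem map_generator_galois (φ : L →+* L) {e : AddChar (ZMod 9) L} {x : ZMod 9 → L}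
    (b : (ZMod 9)ˣ) (he : ∀ a, φ (e a) = e (a * b)) (hx : ∀ j, φ (x j) = x j) :
    (∀ i, φ (evenGenerator e x i) = evenGenerator e x i) ∧
      ∀ i, φ (oddGenerator e x i) = oddGenerator e x i := by
  have h := map_dft_galois φ he hx
  exact map_generator_of_fixed φ (by simp [h])
    (map_period_galois φ b he (map_unitMonomial_galois φ h))
    (map_period_galois φ b he (map_cubicMonomial_galois φ h))

/-- The `u_a` need only their periods at 0 and ±3, since `u_{4a} = u_a` makes those at units vanish.
-/
theorem mem_of_generator_mem {F : Type*} [Field F] [Algebra F L] (N : IntermediateField F L)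
    {e : AddChar (ZMod 9) L} {x : ZMod 9 → L} (h2 : (2 : L) ≠ 0) (h3 : (3 : L) ≠ 0)
    (hep : e.IsPrimitive) (he : ∀ a, e a ∈ N)
    (heven : ∀ i, evenGenerator e x i ∈ N) (hodd : ∀ i, oddGenerator e x i ∈ N) :
    (∀ a : (ZMod 9)ˣ, unitMonomial e x a ∈ N) ∧ ∀ a : (ZMod 9)ˣ, cubicMonomial e x a ∈ N := by
  have h9 : (9 : L) ≠ 0 := by
    rw [show (9 : L) = 3 * 3 by norm_num]; exact mul_ne_zero h3 h3
  have hzero {k : ZMod 9} (hk : IsUnit k) : period e (cubicMonomial e x) k = 0 :=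
    period_eq_zero h3 hep (cubicMonomial_four_mul e x) hk
  refine ⟨mem_of_period_mem N h9 h2 hep he ?_ ?_, mem_of_period_mem N h9 h2 hep he ?_ ?_⟩
  · rintro k (rfl | rfl | rfl)
    exacts [heven 1, heven 2, heven 3]
  · rintro k (rfl | rfl | rfl)
    exacts [hodd 0, hodd 1, hodd 2]
  · rintro k (rfl | rfl | rfl)
    · exact heven 4
    · rw [hzero (by decide), hzero (by decide), add_zero]; exact zero_mem N
    · rw [hzero (by decide), hzero (by decide), add_zero]; exact zero_mem N
  · rintro k (rfl | rfl | rfl)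
    · rw [hzero (by decide), hzero (by decide), sub_zero]; exact zero_mem N
    · rw [hzero (by decide), hzero (by decide), sub_zero]; exact zero_mem N
    · exact hodd 3

/-- Adjoining `ζ`, `p` and `y_1` successively to `F` gives all of `L`, whence the bound `6 * 2 * 9 =
108`. The element `p` stands for an odd generator over which all odd generators become rational. -/
theorem finrank_le_of_generator_mem {F : Type*} [Field F] [Algebra F E] [Algebra F L]
    [IsScalarTower F E L] [CharZero E] (hirr : Irreducible (Polynomial.cyclotomic 9 E)) {ζ : L}
    (hζ : IsPrimitiveRoot ζ 9) (hζtop : IntermediateField.adjoin E {ζ} = ⊤)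
    {x : ZMod 9 → E} (hx : x 0 ≠ x 6) (hxtop : IntermediateField.adjoin F (Set.range x) = ⊤)
    {e : AddChar (ZMod 9) L} (he : e = AddChar.zmodChar 9 hζ.pow_eq_one)
    (heven : ∀ i, evenGenerator e (fun j => algebraMap E L (x j)) i ∈
      (algebraMap F L).range) {p : L} (hp : p ^ 2 ∈ (algebraMap F L).range)
    (hodd : ∀ N : IntermediateField F L, p ∈ N →
      ∀ i, oddGenerator e (fun j => algebraMap E L (x j)) i ∈ N) :
    FiniteDimensional F L ∧ Module.finrank F L ≤ 108 := by
  have : CharZero L := charZero_of_injective_algebraMap (algebraMap E L).injective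
  have base {N : IntermediateField F L} {c : L} (hc : c ∈ (algebraMap F L).range) : c ∈ N := by
    obtain ⟨d, rfl⟩ := hc
    exact N.algebraMap_mem d
  have hep : e.IsPrimitive := he ▸ AddChar.zmodChar_primitive_of_primitive_root 9 hζ
  obtain ⟨N₁, -, hζ₁, _, hN₁⟩ := (⊥ : IntermediateField F L).exists_finrank_le_mul_natDegree
    (Polynomial.cyclotomic.monic 9 _) (a := ζ) (by
      rw [Polynomial.aeval_def, Polynomial.eval₂_eq_eval_map, Polynomial.map_cyclotomic]
      exact hζ.isRoot_cyclotomic (by norm_num))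
  obtain ⟨N₂, h₁₂, hp₂, _, hN₂⟩ := N₁.exists_finrank_le_mul_of_pow_mem two_ne_zero (base hp)
  have he₂ (a : ZMod 9) : e a ∈ N₂ := by
    rw [he, AddChar.zmodChar_apply]
    exact pow_mem (h₁₂ hζ₁) _
  obtain ⟨hz, hu⟩ := mem_of_generator_mem N₂ two_ne_zero three_ne_zero hep he₂
    (fun i => base (heven i)) (hodd N₂ hp₂)
  have hy (a : (ZMod 9)ˣ) : dft e (fun j => algebraMap E L (x j)) a ≠ 0 := by
    have : NeZero (9 : E) := ⟨by norm_num⟩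
    rw [he]; exact dft_ne_zero hirr hζ hx a
  obtain ⟨N₃, h₂₃, hy₃, _, hN₃⟩ := N₂.exists_finrank_le_mul_of_pow_mem (n := 9) (by norm_num)
    (dft_one_pow_mem N₂ hy hz)
  have hx₃ (j : ZMod 9) : algebraMap E L (x j) ∈ N₃ :=
    mem_of_unitMonomial_mem N₃ (by norm_num) hep (fun a => h₂₃ (he₂ a)) hy (fun a => h₂₃ (hz a))
      (fun a => h₂₃ (hu a)) (base (heven 0)) hy₃ j
  have hE₃ (c : E) : algebraMap E L c ∈ N₃ := by
    have hle : IntermediateField.adjoin F (Set.range x) ≤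
        N₃.comap (IsScalarTower.toAlgHom F E L) :=
      IntermediateField.adjoin_le_iff.2 (Set.range_subset_iff.2 hx₃)
    exact hle (hxtop ▸ IntermediateField.mem_top)
  have htop : N₃ = ⊤ := by
    rw [eq_top_iff]
    intro c _
    have hc : c ∈ IntermediateField.adjoin E {ζ} := hζtop ▸ IntermediateField.mem_top
    have hle : IntermediateField.adjoin E {ζ} ≤ N₃.toSubfield.toIntermediateField hE₃ :=
      IntermediateField.adjoin_le_iff.2 (Set.singleton_subset_iff.2 (h₂₃ (h₁₂ hζ₁)))
    exact hle hc
  subst htop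
  refine ⟨Module.Finite.equiv (IntermediateField.topEquiv (F := F) (E := L)).toLinearEquiv, ?_⟩
  rw [IntermediateField.finrank_top'] at hN₃
  have hφ : Nat.totient 9 = 6 := by decide
  rw [IntermediateField.finrank_bot, Polynomial.natDegree_cyclotomic, hφ] at hN₁
  omega

/-- If the dihedral group of order `18` acts on a field `E` and permutes `x 0, …, x 8` dihedrally,
then there are nine invariants such that `E` has degree at most `18` over every subfield that
contains them and together with the `x j` generates `E`. -/
theorem exists_dihedral_invariants {E : Type u} [Field E] [CharZero E]
    (hirr : Irreducible (Polynomial.cyclotomic 9 E)) {x : ZMod 9 → E} (hx : x 0 ≠ x 6)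
    {ρ : DihedralGroup 9 → E →+* E} (hρ : ∀ g j, ρ g (x j) = x (g • j)) :
    ∃ s : Fin 5 ⊕ Fin 4 → E, (∀ g i, ρ g (s i) = s i) ∧
      ∀ (F : Type u) [Field F] [Algebra F E], (∀ i, s i ∈ (algebraMap F E).range) →
        IntermediateField.adjoin F (Set.range x) = ⊤ →
          FiniteDimensional F E ∧ Module.finrank F E ≤ 18 := by
  obtain ⟨L, _, _, ζ, hζ, hζtop, hcyc, hlift⟩ := exists_cyclotomic_extension_lift hirr
  have : FiniteDimensional E L := IsCyclotomicExtension.finiteDimensional {9} E L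
  have : IsGalois E L := IsCyclotomicExtension.isGalois {9} E L
  obtain ⟨e, he⟩ : ∃ e : AddChar (ZMod 9) L, e = AddChar.zmodChar 9 hζ.pow_eq_one := ⟨_, rfl⟩
  set X : ZMod 9 → L := fun j => algebraMap E L (x j) with hX
  have hgal (g : L ≃ₐ[E] L) : (∀ i, g (evenGenerator e X i) = evenGenerator e X i) ∧
      ∀ i, g (oddGenerator e X i) = oddGenerator e X i := by
    obtain ⟨b, hb⟩ := hζ.exists_unit_map_zmodChar g
    exact map_generator_galois (g : L →+* L) b (he ▸ hb) fun j => g.commutes _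
  have descend {c : L} (hc : ∀ g : L ≃ₐ[E] L, g c = c) : ∃ d, algebraMap E L d = c :=
    IntermediateField.mem_bot.1 ((IsGalois.mem_bot_iff_fixed c).2 hc)
  choose ev hev using fun i => descend fun g => (hgal g).1 i
  choose od hod using fun i => descend fun g => (hgal g).2 i
  have inj := (algebraMap E L).injective
  have haction (g : DihedralGroup 9) : (∀ i, ρ g (ev i) = ev i) ∧
      ((∀ i, ρ g (od i) = od i) ∨ ∀ i, ρ g (od i) = -od i) := by
    obtain ⟨ψ, hψ, hψζ⟩ := hlift (ρ g)
    obtain ⟨h1, h2⟩ := map_generator_dihedral ψ (e := e) (x := X) (g := g)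
      (fun a => by rw [he, AddChar.zmodChar_apply, map_pow, hψζ])
      (fun j => by simp only [hX, hψ, hρ])
    refine ⟨fun i => inj (by rw [← hψ, hev, h1]), h2.imp (fun h i => inj ?_) fun h i => inj ?_⟩
    · rw [← hψ, hod, h]
    · rw [← hψ, map_neg, hod, h]
  -- A nonzero odd generator serves as `p`; if all of them vanish, any index does. This avoids
  -- proving that one is nonzero.
  obtain ⟨p, hp⟩ : ∃ p, ∀ i, od p = 0 → od i = 0 := by
    by_cases h : ∃ p, od p ≠ 0
    · obtain ⟨p, hp⟩ := h
      exact ⟨p, fun i h => absurd h hp⟩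
    · push Not at h
      exact ⟨0, fun i _ => h i⟩
  -- A reflection changes both signs in `od p * od i`. The case `i = p` puts the square of `od p`
  -- into `F`.
  refine ⟨Sum.elim ev fun i => od p * od i, fun g i => ?_, fun F _ _ hs hxtop => ?_⟩
  · obtain ⟨h1, h2⟩ := haction g
    rcases i with i | i
    · exact h1 i
    · rcases h2 with h2 | h2 <;> simp [h2]
  · let _ : Algebra F L := Algebra.compHom L (algebraMap F E)
    have : IsScalarTower F E L := IsScalarTower.of_algebraMap_eq fun _ => rfl
    have hmem {c : E} (hc : c ∈ (algebraMap F E).range) :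
        algebraMap E L c ∈ (algebraMap F L).range := by
      obtain ⟨d, rfl⟩ := hc
      exact ⟨d, IsScalarTower.algebraMap_apply F E L d⟩
    obtain ⟨_, hfin⟩ := finrank_le_of_generator_mem (F := F) hirr hζ hζtop hx hxtop he
      (fun i => hev i ▸ hmem (hs (.inl i))) (p := algebraMap E L (od p))
      (by rw [← map_pow, sq]; exact hmem (hs (.inr p)))
      (fun N hpN i => by
        rw [← hX, ← hod]
        by_cases h0 : od p = 0
        · rw [hp i h0, map_zero]; exact zero_mem N
        · have hpi : algebraMap E L (od p * od i) ∈ N := by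
            obtain ⟨d, hd⟩ := hmem (hs (.inr i))
            exact hd ▸ N.algebraMap_mem d
          have : algebraMap E L (od i) =
              algebraMap E L (od p * od i) / algebraMap E L (od p) := by
            rw [← map_div₀, mul_div_cancel_left₀ _ h0]
          exact this ▸ div_mem hpi hpN)
    refine ⟨FiniteDimensional.left F E L, ?_⟩
    have h6 : Module.finrank E L = 6 := by
      rw [IsCyclotomicExtension.finrank L hirr]; decide
    have := Module.finrank_mul_finrank F E L
    rw [h6] at this
    omega

end NonicPeriods

/-! ### Rational function fields and the rationality criterion -/

namespace RatFunField

variable {K : Type*} [Field K] {ι : Type*}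

theorem X_injective : Function.Injective (X K : ι → RatFunField K ι) :=
  (IsFractionRing.injective (MvPolynomial ι K) (RatFunField K ι)).comp
    (MvPolynomial.X_injective (R := K))

instance [CharZero K] : CharZero (RatFunField K ι) :=
  charZero_of_injective_algebraMap (algebraMap K (RatFunField K ι)).injective

instance : Algebra.IsAlgebraic (MvPolynomial ι K) (RatFunField K ι) :=
  IsLocalization.isAlgebraic _ (nonZeroDivisors (MvPolynomial ι K))

/-- Setting all variables to zero preserves this monic polynomial, so irreducibility over `K` lifts
to the polynomial ring; Gauss's lemma passes to the fraction field. -/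
theorem irreducible_cyclotomic {n : ℕ} (hn : Irreducible (Polynomial.cyclotomic n K)) :
    Irreducible (Polynomial.cyclotomic n (RatFunField K ι)) := by
  have h : Irreducible (Polynomial.cyclotomic n (MvPolynomial ι K)) := by
    refine (Polynomial.cyclotomic.monic n _).irreducible_of_irreducible_map
      (MvPolynomial.constantCoeff (σ := ι) (R := K)) _ ?_
    rwa [Polynomial.map_cyclotomic]
  rw [(Polynomial.cyclotomic.monic n _).irreducible_iff_irreducible_map_fraction_map
    (K := RatFunField K ι), Polynomial.map_cyclotomic] at h
  exact h

theorem eq_top_of_X_mem {F : Type*} [Field F] [Algebra F (RatFunField K ι)]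
    [Algebra K F] [IsScalarTower K F (RatFunField K ι)]
    (M : IntermediateField F (RatFunField K ι)) (hX : ∀ i, X K i ∈ M) : M = ⊤ := by
  rw [eq_top_iff]
  intro f _
  have hpoly (p : MvPolynomial ι K) :
      algebraMap (MvPolynomial ι K) (RatFunField K ι) p ∈ M := by
    induction p using MvPolynomial.induction_on with
    | C c =>
      change algebraMap K (RatFunField K ι) c ∈ M
      rw [IsScalarTower.algebraMap_apply K F]
      exact M.algebraMap_mem _
    | add p q hp hq => rw [map_add]; exact add_mem hp hq
    | mul_X p i hp => rw [map_mul]; exact mul_mem hp (hX i)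
  obtain ⟨p, q, -, rfl⟩ := IsFractionRing.div_surjective (A := MvPolynomial ι K) f
  exact div_mem (hpoly p) (hpoly q)

theorem isTranscendenceBasis_X : IsTranscendenceBasis K (X K : ι → RatFunField K ι) :=
  (IsTranscendenceBasis.mvPolynomial ι K).algebraMap_comp

end RatFunField

/-- A faithful action gives distinct automorphisms over the fixed field, and their number is at most
the degree. -/
theorem card_le_finrank_permFixedField (K G ι : Type*) [Field K] [Group G] [MulAction G ι]
    [FaithfulSMul G ι] [FiniteDimensional (permFixedField K G ι) (RatFunField K ι)] :
    Nat.card G ≤ Module.finrank (permFixedField K G ι) (RatFunField K ι) := by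
  let toAut (g : G) : RatFunField K ι ≃ₐ[permFixedField K G ι] RatFunField K ι :=
    AlgEquiv.ofRingEquiv (f := (permVars K G ι g).toRingEquiv)
      fun c => (mem_permFixedField_iff K G _).1 c.2 g
  have hinj : Function.Injective toAut := by
    intro g h hgh
    refine FaithfulSMul.eq_of_smul_eq_smul fun i : ι => RatFunField.X_injective (K := K) ?_
    rw [← permVars_X, ← permVars_X]
    exact DFunLike.congr_fun hgh (RatFunField.X K i)
  refine (Nat.card_le_card_of_injective toAut hinj).trans ?_
  rw [Nat.card_eq_fintype_card]
  exact AlgEquiv.card_le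

theorem IntermediateField.finiteDimensional_of_le {K L : Type*} [Field K] [Field L] [Algebra K L]
    {F E : IntermediateField K L} (h : F ≤ E) [FiniteDimensional F L] : FiniteDimensional E L := by
  let := (IntermediateField.inclusion h).toAlgebra
  have : IsScalarTower F E L := .of_algebraMap_eq' rfl
  exact Module.Finite.of_restrictScalars_finite F E L

open IntermediateField in
/-- Invariants in the number of the variables over which the rational function field has degree at
most the order of the group generate a rational fixed field. -/
theorem isRationalExt_permFixedField {K G ι κ : Type*} [Field K] [Group G] [MulAction G ι]
    [FaithfulSMul G ι] [Finite κ] [Finite ι] (hcard : Nat.card κ = Nat.card ι)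
    (s : κ → RatFunField K ι) (hs : ∀ g i, permVars K G ι g (s i) = s i)
    (hfin : FiniteDimensional (adjoin K (Set.range s)) (RatFunField K ι))
    (hrank : Module.finrank (adjoin K (Set.range s)) (RatFunField K ι) ≤ Nat.card G) :
    IsRationalExt (permFixedField K G ι) := by
  have hle : adjoin K (Set.range s) ≤ permFixedField K G ι := by
    rw [adjoin_le_iff, Set.range_subset_iff]
    exact fun i => (mem_permFixedField_iff K G _).2 fun g => hs g i
  have : FiniteDimensional (permFixedField K G ι) (RatFunField K ι) := finiteDimensional_of_le hle
  -- The two degrees are squeezed together by the order of `G`.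
  have heq : adjoin K (Set.range s) = permFixedField K G ι :=
    eq_of_le_of_finrank_le' hle (hrank.trans (card_le_finrank_permFixedField K G ι))
  have halg : Algebra.IsAlgebraic (Algebra.adjoin K (Set.range s)) (RatFunField K ι) := by
    open IntermediateField.algebraAdjoinAdjoin in
    exact (IsFractionRing.comap_isAlgebraic_iff (A := Algebra.adjoin K (Set.range s))
      (K := adjoin K (Set.range s))).2 inferInstance
  -- The field is algebraic over the subalgebra generated by `s`, and `s` has no more members than
  -- the transcendence degree, so no member is redundant.
  have hbasis : IsTranscendenceBasis K s := by
    refine Algebra.IsAlgebraic.isTranscendenceBasis_of_lift_le_trdeg_of_finite K s ?_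
    have htr := (RatFunField.isTranscendenceBasis_X (K := K) (ι := ι)).lift_cardinalMk_eq_trdeg
    have hnat : Cardinal.toNat (Algebra.trdeg K (RatFunField K ι)) = Nat.card ι := by
      rw [← Cardinal.toNat_lift, ← htr, Cardinal.toNat_lift]; rfl
    have hlt : Algebra.trdeg K (RatFunField K ι) < Cardinal.aleph0 := by
      rw [← Cardinal.lift_lt_aleph0, ← htr, Cardinal.lift_lt_aleph0]
      exact Cardinal.mk_lt_aleph0
    have := Fintype.ofFinite κ
    rw [← Cardinal.cast_toNat_of_lt_aleph0 hlt, hnat, ← hcard, Cardinal.lift_natCast,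
      Nat.card_eq_fintype_card, Cardinal.mk_fintype, Cardinal.lift_natCast]
  exact ⟨Set.range s, hbasis.1.coe_range, heq⟩

/-- The Vandermonde system is inverted over `N`: combining the power sums with the coefficients of a
Lagrange basis polynomial isolates `w i`. -/
theorem IntermediateField.mem_of_sum_pow_mul_mem {F E ι : Type*} [Field F] [Field E] [Algebra F E]
    [Fintype ι] (N : IntermediateField F E) {y w : ι → E} (hy : Function.Injective y)
    (hyN : ∀ i, y i ∈ N) (h : ∀ k < Fintype.card ι, ∑ i, y i ^ k * w i ∈ N) (i : ι) :
    w i ∈ N := by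
  classical
  set v : ι → N := fun i => ⟨y i, hyN i⟩
  have hv : Set.InjOn v (Finset.univ : Finset ι) :=
    fun i _ j _ hij => hy (congrArg Subtype.val hij)
  set P := Lagrange.basis Finset.univ v i with hP
  have hdeg : P.natDegree < Fintype.card ι := by
    have := Lagrange.degree_basis hv (Finset.mem_univ i)
    rw [Polynomial.natDegree_eq_of_degree_eq_some this, Finset.card_univ]
    exact Nat.sub_one_lt (Fintype.card_pos_iff.2 ⟨i⟩).ne'
  have heval (j : ι) : ∑ k ∈ Finset.range (Fintype.card ι), (P.coeff k : E) * y j ^ k =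
      if j = i then 1 else 0 := by
    have : ((P.eval (v j) : N) : E) = if j = i then 1 else 0 := by
      split_ifs with hji
      · rw [hji, hP, Lagrange.eval_basis_self hv (Finset.mem_univ i)]; rfl
      · rw [hP, Lagrange.eval_basis_of_ne (Ne.symm hji) (Finset.mem_univ j)]; rfl
    rw [← this, Polynomial.eval_eq_sum_range' hdeg]
    simp [v]
  have hw : w i = ∑ k ∈ Finset.range (Fintype.card ι),
      (P.coeff k : E) * ∑ j, y j ^ k * w j := by
    simp only [Finset.mul_sum, ← mul_assoc]
    rw [Finset.sum_comm]
    simp only [← Finset.sum_mul, heval]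
    simp
  rw [hw]
  exact sum_mem fun k hk => mul_mem (P.coeff k).2 (h k (Finset.mem_range.1 hk))

/-- The images of 0 and 1 suffice: a rotation agreeing with a reflection at both would force `2 =
0`. -/
instance dihedral_faithfulSMul_zmod {n : ℕ} [Fact (2 < n)] :
    FaithfulSMul (DihedralGroup n) (ZMod n) where
  eq_of_smul_eq_smul := by
    have h2 : (2 : ZMod n) ≠ 0 := by
      have h : 2 < n := Fact.out
      intro h0
      have := (ZMod.natCast_eq_zero_iff 2 n).1 (by exact_mod_cast h0)
      exact absurd (Nat.le_of_dvd two_pos this) (by omega)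
    rintro (a | a) (b | b) h
    · have h0 : a + 0 = b + 0 := h 0
      rw [add_zero, add_zero] at h0
      rw [h0]
    · have h0 : a + 0 = -(b + 0) := h 0
      have h1 : a + 1 = -(b + 1) := h 1
      exact absurd (by linear_combination h1 - h0) h2
    · have h0 : -(a + 0) = b + 0 := h 0
      have h1 : -(a + 1) = b + 1 := h 1
      exact absurd (by linear_combination h0 - h1) h2
    · have h0 : -(a + 0) = -(b + 0) := h 0
      rw [add_zero, add_zero, neg_inj] at h0
      rw [h0]

/-! ### The regular representation in terms of coset sums and differences -/

namespace NoetherDihedral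

/-- The orbit sums of right multiplication by the reflection `sr 0`. -/
def cosetSum (K : Type*) [Field K] {n : ℕ} (i : ZMod n) : RatFunField K (DihedralGroup n) :=
  RatFunField.X K (.r i) + RatFunField.X K (.sr (-i))

/-- The alternating orbit sums of right multiplication by the reflection `sr 0`. -/
def cosetDiff (K : Type*) [Field K] {n : ℕ} (i : ZMod n) : RatFunField K (DihedralGroup n) :=
  RatFunField.X K (.r i) - RatFunField.X K (.sr (-i))

variable {K : Type*} [Field K] {n : ℕ}

theorem permVars_r_cosetSum (t i : ZMod n) :
    permVars K (DihedralGroup n) (DihedralGroup n) (.r t) (cosetSum K i) = cosetSum K (t + i) := by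
  simp only [cosetSum, map_add, permVars_X, smul_eq_mul, DihedralGroup.r_mul_r,
    DihedralGroup.r_mul_sr]
  rw [show -i - t = -(t + i) by ring]

theorem permVars_sr_cosetSum (t i : ZMod n) :
    permVars K (DihedralGroup n) (DihedralGroup n) (.sr t) (cosetSum K i) =
      cosetSum K (-(t + i)) := by
  simp only [cosetSum, map_add, permVars_X, smul_eq_mul, DihedralGroup.sr_mul_r,
    DihedralGroup.sr_mul_sr]
  rw [show -i - t = -(t + i) by ring, neg_neg, add_comm]

theorem permVars_r_cosetDiff (t i : ZMod n) :
    permVars K (DihedralGroup n) (DihedralGroup n) (.r t) (cosetDiff K i) = cosetDiff K (t + i) := by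
  simp only [cosetDiff, map_sub, permVars_X, smul_eq_mul, DihedralGroup.r_mul_r,
    DihedralGroup.r_mul_sr]
  rw [show -i - t = -(t + i) by ring]

theorem permVars_sr_cosetDiff (t i : ZMod n) :
    permVars K (DihedralGroup n) (DihedralGroup n) (.sr t) (cosetDiff K i) =
      -cosetDiff K (-(t + i)) := by
  simp only [cosetDiff, map_sub, permVars_X, smul_eq_mul, DihedralGroup.sr_mul_r,
    DihedralGroup.sr_mul_sr]
  rw [show -i - t = -(t + i) by ring, neg_neg, neg_sub]

theorem cosetSum_injective : Function.Injective (cosetSum K : ZMod n → _) := by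
  intro i j hij
  by_contra hne
  have hp : (MvPolynomial.X (.r i) + MvPolynomial.X (.sr (-i)) :
      MvPolynomial (DihedralGroup n) K) = MvPolynomial.X (.r j) + MvPolynomial.X (.sr (-j)) := by
    refine IsFractionRing.injective _ (RatFunField K (DihedralGroup n)) ?_
    rw [map_add, map_add]
    exact hij
  classical
  -- At the point with coordinate 1 at `r i` and 0 elsewhere, the two sides are 1 and 0.
  have := congrArg (MvPolynomial.eval (Pi.single (.r i) (1 : K))) hp
  simp [Ne.symm hne] at this

/-- Invariants that are linear in the alternating orbit sums. -/
def linearInvariant (K : Type*) [Field K] (n : ℕ) [NeZero n] (k : ℕ) : RatFunField K (DihedralGroup n) :=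
  ∑ i : ZMod n, cosetSum K i ^ k * ((cosetSum K (i + 1) - cosetSum K (i - 1)) * cosetDiff K i)

/-- A reflection exchanges the neighbours `i + 1` and `i - 1`, and the resulting sign cancels that
of `cosetDiff`. -/
theorem permVars_linearInvariant [NeZero n] (g : DihedralGroup n) (k : ℕ) :
    permVars K (DihedralGroup n) (DihedralGroup n) g (linearInvariant K n k) =
      linearInvariant K n k := by
  rcases g with t | t
  · simp only [linearInvariant, map_sum, map_mul, map_sub, map_pow, permVars_r_cosetSum,
      permVars_r_cosetDiff]
    refine Fintype.sum_equiv (Equiv.addLeft t) _ _ fun i => ?_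
    rw [Equiv.coe_addLeft, add_assoc, add_sub_assoc]
  · simp only [linearInvariant, map_sum, map_mul, map_sub, map_pow, permVars_sr_cosetSum,
      permVars_sr_cosetDiff]
    refine Fintype.sum_equiv ((Equiv.addLeft t).trans (Equiv.neg _)) _ _ fun i => ?_
    rw [Equiv.trans_apply, Equiv.coe_addLeft, Equiv.neg_apply,
      show -(t + (i + 1)) = -(t + i) - 1 by ring, show -(t + (i - 1)) = -(t + i) + 1 by ring]
    ring

/-- The coset sums are distinct, so the first `n` linear invariants determine the products in which
`cosetDiff` occurs. The factor to divide by is nonzero because `i + 1 ≠ i - 1`. -/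
theorem eq_top_of_cosetSum_mem [CharZero K] [NeZero n] (hn : (2 : ZMod n) ≠ 0) {F : Type*} [Field F]
    [Algebra F (RatFunField K (DihedralGroup n))] [Algebra K F]
    [IsScalarTower K F (RatFunField K (DihedralGroup n))]
    (M : IntermediateField F (RatFunField K (DihedralGroup n)))
    (hy : ∀ i : ZMod n, cosetSum K i ∈ M) (hl : ∀ k < n, linearInvariant K n k ∈ M) : M = ⊤ := by
  have hz (i : ZMod n) : cosetDiff K i ∈ M := by
    have h0 : (cosetSum K (i + 1) - cosetSum K (i - 1) : RatFunField K (DihedralGroup n)) ≠ 0 :=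
      sub_ne_zero.2 fun h => hn (by linear_combination cosetSum_injective h)
    have hw : (cosetSum K (i + 1) - cosetSum K (i - 1)) * cosetDiff K i ∈ M :=
      M.mem_of_sum_pow_mul_mem (w := fun i => (cosetSum K (i + 1) - cosetSum K (i - 1)) * cosetDiff K i)
        cosetSum_injective hy (fun k hk => hl k (by rwa [ZMod.card] at hk)) i
    rw [← mul_div_cancel_left₀ (cosetDiff K i) h0]
    exact div_mem hw (sub_mem (hy _) (hy _))
  refine RatFunField.eq_top_of_X_mem M fun g => ?_
  · rcases g with i | i
    · have : RatFunField.X K (.r i) = (cosetSum K i + cosetDiff K i) / 2 := by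
        rw [cosetSum, cosetDiff]; ring
      exact this ▸ div_mem (add_mem (hy i) (hz i)) (ofNat_mem M 2)
    · have : RatFunField.X K (.sr i) = (cosetSum K (-i) - cosetDiff K (-i)) / 2 := by
        rw [cosetSum, cosetDiff, neg_neg]; ring
      exact this ▸ div_mem (sub_mem (hy _) (hz _)) (ofNat_mem M 2)

end NoetherDihedral

/-! ### Rationality of the two fixed fields -/

theorem isRationalExt_permFixedField_zmod_nine {K : Type*} [Field K] [CharZero K]
    (hirr : Irreducible (Polynomial.cyclotomic 9 K)) :
    IsRationalExt (permFixedField K (DihedralGroup 9) (ZMod 9)) := by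
  have : Fact (2 < 9) := ⟨by norm_num⟩
  obtain ⟨s, hs, hrank⟩ := NonicPeriods.exists_dihedral_invariants
    (RatFunField.irreducible_cyclotomic (ι := ZMod 9) hirr)
    (x := RatFunField.X K) (fun h => absurd (RatFunField.X_injective h) (by decide))
    (ρ := fun g => (permVars K (DihedralGroup 9) (ZMod 9) g : _ →+* _))
    (permVars_X K (DihedralGroup 9))
  have hmem (i) : s i ∈ IntermediateField.adjoin K (Set.range s) :=
    IntermediateField.subset_adjoin K _ ⟨i, rfl⟩
  obtain ⟨hfin, hle⟩ := hrank (IntermediateField.adjoin K (Set.range s))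
    (fun i => ⟨⟨s i, hmem i⟩, rfl⟩)
    (RatFunField.eq_top_of_X_mem _ fun i => IntermediateField.subset_adjoin _ _ ⟨i, rfl⟩)
  exact isRationalExt_permFixedField (by simp) s hs hfin
    (hle.trans_eq (DihedralGroup.nat_card (n := 9)).symm)

theorem isRationalExt_noetherField_dihedral_nine {K : Type*} [Field K] [CharZero K]
    (hirr : Irreducible (Polynomial.cyclotomic 9 K)) :
    IsRationalExt (noetherField K (DihedralGroup 9)) := by
  obtain ⟨s, hs, hrank⟩ := NonicPeriods.exists_dihedral_invariants
    (RatFunField.irreducible_cyclotomic (ι := DihedralGroup 9) hirr)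
    (x := NoetherDihedral.cosetSum K)
    (fun h => absurd (NoetherDihedral.cosetSum_injective h) (by decide))
    (ρ := fun g => (permVars K (DihedralGroup 9) (DihedralGroup 9) g : _ →+* _)) (by
      rintro (t | t) j
      exacts [NoetherDihedral.permVars_r_cosetSum t j, NoetherDihedral.permVars_sr_cosetSum t j])
  -- Nine invariants from the coset sums and nine linear ones match the 18 variables.
  let t : (Fin 5 ⊕ Fin 4) ⊕ Fin 9 → RatFunField K (DihedralGroup 9) :=
    Sum.elim s fun k => NoetherDihedral.linearInvariant K 9 k
  have hmem (i) : t i ∈ IntermediateField.adjoin K (Set.range t) :=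
    IntermediateField.subset_adjoin K _ ⟨i, rfl⟩
  obtain ⟨hfin, hle⟩ := hrank (IntermediateField.adjoin K (Set.range t))
    (fun i => ⟨⟨s i, hmem (.inl i)⟩, rfl⟩)
    (NoetherDihedral.eq_top_of_cosetSum_mem (by decide) _
      (fun i => IntermediateField.subset_adjoin _ _ ⟨i, rfl⟩)
      fun k hk => IntermediateField.algebraMap_mem _
        (⟨_, hmem (.inr ⟨k, hk⟩)⟩ : IntermediateField.adjoin K (Set.range t)))
  refine isRationalExt_permFixedField (by rw [DihedralGroup.nat_card]; simp) t ?_ hfin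
    (hle.trans_eq (DihedralGroup.nat_card (n := 9)).symm)
  rintro g (i | k)
  exacts [hs g i, NoetherDihedral.permVars_linearInvariant g k]

end

theorem theorem3p1 :
    IsRationalExt (permFixedField ℚ (DihedralGroup 9) (ZMod 9)) ∧
      IsRationalExt (noetherField ℚ (DihedralGroup 9)) := by
  have hirr := Polynomial.cyclotomic.irreducible_rat (n := 9) (by norm_num)
  exact ⟨isRationalExt_permFixedField_zmod_nine hirr,
    isRationalExt_noetherField_dihedral_nine hirr⟩
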